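/- Let $(X,\mathcal A)$ be a measurable space, $P$ a measure on $X\times[-1,1]$ with marginal $P_X$ on $X$, and $k$ a measurable kernel on $X$ whose reproducing kernel Hilbert space $H$ (real-valued functions) is compactly embedded into $\mathrm L^2(P_X)$, i.e. every $f\in H$ is square integrable and $I_k:H\to \mathrm L^2(P_X)$, $f\mapsto[f]_\sim$ (class modulo $P_X$-a.e. equality), is a compact operator. Let $[H]_\sim=I_k(H)$ carry the quotient norm $\|u\|_{[H]_\sim}=\inf\{\|f\|_H: [f]_\sim=u\}$. Let $(\mu_i)_{i\in I}$ be the nonzero eigenvalues of $T_k=I_kI_k^*$, repeated according to multiplicity, and let $e_i\in H$ be such that $([e_i]_\sim)_{i\in I}$ is an orthonormal system in $\mathrm L^2(P_X)$ of corresponding eigenvectors of $T_k$, spanning all eigenspaces to nonzero eigenvalues, and $(\sqrt{\mu_i}\,e_i)_{i\in I}$ is an orthonormal system in $H$. Assume $\mu_i\le 1$ for all $i\in I$. For $0<\theta<1$, $1\le r\le\infty$ and $x\in \mathrm L^2(P_X)$, put $K(x,t)=\inf_{y\in[H]_\sim}\big(\|x-y\|_{\mathrm L^2(P_X)}+t\|y\|_{[H]_\sim}\big)$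 and $$\|x\|_{\theta,r}=\Big(\int_0^\infty t^{-\theta r-1}K(x,t)^r\,dt\Big)^{1/r}\ (r<\infty),\qquad \|x\|_{\theta,\infty}=\sup_{t>0}t^{-\theta}K(x,t),$$ and let $[\mathrm L^2(P_X),[H]_\sim]_{\theta,r}=\{x\in \mathrm L^2(P_X):\|x\|_{\theta,r}<\infty\}$. An admissible filter is a family of functions $g_\lambda:[0,1]\to\mathbb R$, $0<\lambda\le1$, such that $\sup_{0<\lambda,\mu\le1}|\lambda g_\lambda(\mu)|<\infty$, $\sup_{0<\lambda,\mu\le1}|\mu g_\lambda(\mu)|<\infty$, $\lim_{\lambda\to0}\mu g_\lambda(\mu)=1$ for all $0<\mu\le1$, and, for some $\alpha_0>0$, $\sup_{0<\lambda,\mu\le1}|1-\mu g_\lambda(\mu)|\mu^\alpha\lambda^{-\alpha}<\infty$ for all $0<\alpha\le\alpha_0$. **Proposition.** Let $0<\beta<1$, $0<\theta<1$ and $1\le r\le\infty$. There are finite constants $C_1,C_2\ge0$ such that the following holds for every measurable loss $L:\mathbb R\times\mathbb R\to[0,\infty)$, every Bayes decision function $f^*=f^*_{L,P}$ (a measurable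 function $X\to\mathbb R$ minimising $f\mapsto\int L(y,f(x))\,dP(x,y)$ over all measurable $f:X\to\mathbb R$) whose class $[f^*]_\sim$, again written $f^*$, lies in $[\mathrm L^2(P_X),[H]_\sim]_{\beta,r}$, every admissible filter $g$ and every $0<\lambda\le1$. The series $$f_{P,\lambda,g}=\sum_{i\in I}\mu_i g_\lambda(\mu_i)\langle f^*,[e_i]_\sim\rangle_{\mathrm L^2(P_X)}\,e_i$$ converges unconditionally in $H$, and $$\big\|[f_{P,\lambda,g}]_\sim-f^*\big\|_{\theta,r}\le C_1\,\sup_{i\in I}\Big(|1-\mu_i g_\lambda(\mu_i)|\,\mu_i^{\frac{\beta-\theta}2}\Big)\,\|f^*\|_{\beta,r},$$ $$\big\|[f_{P,\lambda,g}]_\sim\big\|_{\theta,r}\le C_2\,\sup_{i\in I}\Big(|\mu_i g_\lambda(\mu_i)|\,\mu_i^{\frac{\beta-\theta}2}\Big)\,\|f^*\|_{\beta,r}.$$ Both inequalities are understood in $[0,\infty]$ with $\infty\cdot0=0$ and the supremum over an empty $I$ equal to $0$; the constants do not depend on $\lambda$, $g$, $L$ or $f^*$. -/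

import Mathlib

open scoped ENNReal NNReal Topology
open MeasureTheory

noncomputable section

/-! ### The K-method of real interpolation -/

section Interpolation

variable {E : Type*} [NormedAddCommGroup E]

/-- The K-functional `K(x, t, E, S) = inf_{y ∈ S} (‖x - y‖_E + t ‖y‖_S)` for a space `S ⊆ E` that
carries its own norm `N`. -/
def kFunctional (S : Set E) (N : E → ℝ≥0∞) (x : E) (t : ℝ) : ℝ≥0∞ :=
  ⨅ y ∈ S, (‖x - y‖ₑ + ENNReal.ofReal t * N y)

/-- The norm of the real interpolation space `[E, S]_{θ, r}` (with value `∞` outside it), namely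
`(∫_0^∞ t^{-θ r - 1} K(x, t)^r dt)^{1/r}` for `r < ∞` and `sup_{t > 0} t^{-θ} K(x, t)` for
`r = ∞`. -/
def interpNorm (S : Set E) (N : E → ℝ≥0∞) (θ : ℝ) (r : ℝ≥0∞) (x : E) : ℝ≥0∞ :=
  if r = ∞ then ⨆ t ∈ Set.Ioi (0 : ℝ), ENNReal.ofReal (t ^ (-θ)) * kFunctional S N x t
  else (∫⁻ t in Set.Ioi (0 : ℝ),
    ENNReal.ofReal (t ^ (-θ * r.toReal - 1)) * kFunctional S N x t ^ r.toReal) ^ (1 / r.toReal)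

/-- The real interpolation space `[E, S]_{θ, r}`. -/
def interpSpace (S : Set E) (N : E → ℝ≥0∞) (θ : ℝ) (r : ℝ≥0∞) : Set E :=
  {x | interpNorm S N θ r x < ∞}

end Interpolation

/-! ### Reproducing kernel Hilbert spaces compactly embedded into `L²` -/

section Kernel

variable {X : Type*} [MeasurableSpace X]
  (H : Type*) [NormedAddCommGroup H] [InnerProductSpace ℝ H]

/-- The real-valued reproducing kernel `k` of `H`. -/
def realKernel [CompleteSpace H] [RKHS ℝ H X ℝ] (x y : X) : ℝ := RKHS.kernel H x y 1

/-- The linear map `H → L²(ν)`, `f ↦ [f]_∼`, if all functions in `H` are square integrable. -/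
def classMap [RKHS ℝ H X ℝ] (ν : Measure X) (h : ∀ f : H, MemLp (f : X → ℝ) 2 ν) :
    H →ₗ[ℝ] Lp ℝ 2 ν where
  toFun f := (h f).toLp (f : X → ℝ)
  map_add' f g := by
    rw [← MemLp.toLp_add]
    exact MemLp.toLp_congr _ _ (by rw [RKHS.coe_add])
  map_smul' c f := by
    rw [RingHom.id_apply, ← MemLp.toLp_const_smul]
    exact MemLp.toLp_congr _ _ (by rw [RKHS.coe_smul])

/-- `H` is compactly embedded into `L²(ν)`: every function in `H` is square integrable and
`f ↦ [f]_∼` (which need not be injective) is a compact operator. -/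
structure IsCompactlyEmbedded [RKHS ℝ H X ℝ] (ν : Measure X) : Prop where
  memLp : ∀ f : H, MemLp (f : X → ℝ) 2 ν
  compact : IsCompactOperator (classMap H ν memLp)

variable {H} [RKHS ℝ H X ℝ] {ν : Measure X}

/-- The operator `I_k : H → L²(ν)`, `f ↦ [f]_∼`. -/
def embeddingOp (h : IsCompactlyEmbedded H ν) : H →L[ℝ] Lp ℝ 2 ν :=
  ContinuousLinearMap.mkOfIsCompactOperator h.compact

/-- The integral operator `T_k = I_k I_k^*` on `L²(ν)`. -/
def integralOp [CompleteSpace H] (h : IsCompactlyEmbedded H ν) : Lp ℝ 2 ν →L[ℝ] Lp ℝ 2 ν :=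
  embeddingOp h ∘L ContinuousLinearMap.adjoint (embeddingOp h)

/-- The set `[H]_∼` of equivalence classes of functions in `H`. -/
def classSpace (h : IsCompactlyEmbedded H ν) : Set (Lp ℝ 2 ν) := Set.range (embeddingOp h)

/-- The quotient norm `‖u‖ = inf {‖f‖_H : [f]_∼ = u}` on `[H]_∼`. -/
def classNorm (h : IsCompactlyEmbedded H ν) (u : Lp ℝ 2 ν) : ℝ≥0∞ :=
  ⨅ (f : H) (_ : embeddingOp h f = u), ‖f‖ₑ

/-- `(μ i)` are the nonzero eigenvalues of `T_k`, repeated according to multiplicity, and `(e i)`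
are associated eigenfunctions in `H`: the classes `[e i]_∼` are an orthonormal system in `L²(ν)` of
eigenvectors of `T_k` that exhausts all eigenspaces to nonzero eigenvalues, and `(√(μ i) e i)` is
an orthonormal system in `H`. -/
structure IsEigensystem [CompleteSpace H] (h : IsCompactlyEmbedded H ν) {ι : Type*}
    (μ : ι → ℝ) (e : ι → H) : Prop where
  pos : ∀ i, 0 < μ i
  orthonormal_class : Orthonormal ℝ fun i => embeddingOp h (e i)
  eigen : ∀ i, integralOp h (embeddingOp h (e i)) = μ i • embeddingOp h (e i)
  orthonormal_sqrt : Orthonormal ℝ fun i => √(μ i) • e i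
  exhausts : ∀ c : ℝ, c ≠ 0 → ∀ u : Lp ℝ 2 ν, integralOp h u = c • u →
    u ∈ Submodule.span ℝ {v | ∃ i, μ i = c ∧ v = embeddingOp h (e i)}

end Kernel

/-! ### Learning-theoretic notions -/

section Learning

variable {X : Type*} [MeasurableSpace X]

/-- The risk `R_{L,P}(f) = ∫ L(y, f(x)) dP(x, y)`. -/
def risk (L : ℝ → ℝ → ℝ≥0) (P : Measure (X × Set.Icc (-1 : ℝ) 1)) (f : X → ℝ) : ℝ≥0∞ :=
  ∫⁻ p, (L (p.2 : ℝ) (f p.1) : ℝ≥0∞) ∂P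

/-- `f` is a Bayes decision function: it minimises the risk over all measurable functions. -/
structure IsBayesDecisionFunction (L : ℝ → ℝ → ℝ≥0) (P : Measure (X × Set.Icc (-1 : ℝ) 1))
    (f : X → ℝ) : Prop where
  measurable : Measurable f
  minimal : ∀ f₀ : X → ℝ, Measurable f₀ → risk L P f ≤ risk L P f₀

/-- Admissible filter functions `g_l : [0, 1] → ℝ`, `0 < l ≤ 1` (values `g l m` for other arguments
are irrelevant). -/
structure IsAdmissibleFilter (g : ℝ → ℝ → ℝ) : Prop where
  bounded_param : ∃ B : ℝ, ∀ l ∈ Set.Ioc (0 : ℝ) 1, ∀ m ∈ Set.Ioc (0 : ℝ) 1, |l * g l m| ≤ B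
  bounded_arg : ∃ B : ℝ, ∀ l ∈ Set.Ioc (0 : ℝ) 1, ∀ m ∈ Set.Ioc (0 : ℝ) 1, |m * g l m| ≤ B
  tendsto_one : ∀ m ∈ Set.Ioc (0 : ℝ) 1,
    Filter.Tendsto (fun l => m * g l m) (𝓝[>] 0) (𝓝 1)
  qualification : ∃ α₀ : ℝ, 0 < α₀ ∧ ∀ α : ℝ, 0 < α → α ≤ α₀ → ∃ B : ℝ,
    ∀ l ∈ Set.Ioc (0 : ℝ) 1, ∀ m ∈ Set.Ioc (0 : ℝ) 1,
      |1 - m * g l m| * m ^ α * l ^ (-α) ≤ B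

/-- The terms `μ_i g_l(μ_i) ⟨f^*, [e_i]_∼⟩_{L²(ν)} e_i` of the series defining the spectral
regularisation of `f^*`. -/
def spectralRegTerm {H : Type*} [NormedAddCommGroup H] [InnerProductSpace ℝ H] [RKHS ℝ H X ℝ]
    {ν : Measure X} (h : IsCompactlyEmbedded H ν) {ι : Type*} (μ : ι → ℝ) (e : ι → H)
    (g : ℝ → ℝ → ℝ) (l : ℝ) (u : Lp ℝ 2 ν) (i : ι) : H :=
  (μ i * g l (μ i) * inner ℝ u (embeddingOp h (e i))) • e i

/-- The spectral regularisation `∑_i μ_i g_l(μ_i) ⟨f^*, [e_i]_∼⟩_{L²(ν)} e_i`, a function in `H`. -/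
def spectralReg {H : Type*} [NormedAddCommGroup H] [InnerProductSpace ℝ H] [RKHS ℝ H X ℝ]
    {ν : Measure X} (h : IsCompactlyEmbedded H ν) {ι : Type*} (μ : ι → ℝ) (e : ι → H)
    (g : ℝ → ℝ → ℝ) (l : ℝ) (u : Lp ℝ 2 ν) : H :=
  ∑' i, spectralRegTerm h μ e g l u i

end Learning

end

/-! In the orthonormal system `A (e i)`, with `A = embeddingOp hH`, everything is diagonal. The
class of the regularised function has coefficients `μ i * g l (μ i)` times those of `f^*`, and the
error has the multiplier `μ i * g l (μ i) - 1`. Both inequalities are therefore instances of one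
multiplier estimate, `interpNorm_le_iSup_mul`.

For expansions with coefficients `a i`, the squared K-functional at `t` is comparable, up to a
factor 2 each way, to `∑ |a i|² min(1, t² / μ i)` (`quadFunctional_le`, `kFunctional_sq_le`). If a
multiplier is bounded by `c * μ^((θ - β) / 2)`, then each summand of the new series at `t` is
controlled by a summand of the old one at a dyadic dilate `2^n t` close to `√(μ i)`
(`exists_rpow_mul_min_le`). Summing over all `n` bounds the new K-functional by `c t^(θ - β)` times
a weighted sum of dilates of the old one. The weights are summable, and dilation invariance of `dt /
t` together with Jensen's inequality gives the norm bound (`weightedNorm_le_of_le_tsum_dilate`).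

The error must also have no component orthogonal to the system. This holds because a finite
interpolation norm forces `f^*` into the closure of the range (`hasSum_of_interpNorm_lt_top`). -/

namespace SpectralRegularisation

/-! ### Expansions in orthonormal systems. -/

section Hilbert

variable {E : Type*} [NormedAddCommGroup E] [InnerProductSpace ℝ E]
  {ι : Type*} {u : ι → E}

theorem inner_of_hasSum_smul (hu : Orthonormal ℝ u) {c : ι → ℝ} {x : E}
    (hx : HasSum (fun i => c i • u i) x) (i : ι) : inner ℝ (u i) x = c i := by
  have h := (innerSL ℝ (u i)).hasSum hx
  simp only [innerSL_apply_apply, inner_smul_right] at h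
  classical
  have h' : HasSum (fun j => c j * inner ℝ (u i) (u j)) (c i * inner ℝ (u i) (u i)) := by
    apply hasSum_single i
    intro j hj
    rw [hu.2 hj.symm, mul_zero]
  have := h.unique h'
  rw [this, real_inner_self_eq_norm_sq, hu.1 i]; ring

theorem summable_smul_of_summable_sq [CompleteSpace E] (hu : Orthonormal ℝ u) {c : ι → ℝ}
    (hc : Summable fun i => c i ^ 2) : Summable fun i => c i • u i := by
  have h := (hu.orthogonalFamily.summable_iff_norm_sq_summable (fun i => c i)).2
    (by simpa using hc)
  simpa using h

theorem summable_inner_sq (hu : Orthonormal ℝ u) (x : E) :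
    Summable fun i => inner ℝ (u i) x ^ 2 := by
  simpa using hu.inner_products_summable (x := x)

/-- Bessel's inequality for extended nonnegative reals. -/
theorem tsum_enorm_inner_sq_le (hu : Orthonormal ℝ u) (x : E) :
    ∑' i, ‖inner ℝ (u i) x‖ₑ ^ 2 ≤ ‖x‖ₑ ^ 2 := by
  have h := hu.tsum_inner_products_le (x := x)
  have h2 : ∀ y : ℝ, ‖y‖ₑ ^ 2 = ENNReal.ofReal (‖y‖ ^ 2) := fun y => by
    rw [ENNReal.ofReal_pow (norm_nonneg _), ofReal_norm]
  rw [← ofReal_norm x, ← ENNReal.ofReal_pow (norm_nonneg _)]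
  simp_rw [h2]
  rw [← ENNReal.ofReal_tsum_of_nonneg (fun _ => by positivity) (hu.inner_products_summable (x := x))]
  exact ENNReal.ofReal_le_ofReal h

/-- Parseval's identity for extended nonnegative reals. -/
theorem enorm_sq_eq_tsum (hu : Orthonormal ℝ u) {c : ι → ℝ} {x : E}
    (hx : HasSum (fun i => c i • u i) x) : ‖x‖ₑ ^ 2 = ∑' i, ‖c i‖ₑ ^ 2 := by
  have h := (innerSL ℝ x).hasSum hx
  simp only [innerSL_apply_apply, inner_smul_right, real_inner_self_eq_norm_sq] at h
  have h2 : ∀ y : ℝ, ‖y‖ₑ ^ 2 = ENNReal.ofReal (y * y) := fun y => by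
    rw [← ofReal_norm, ← ENNReal.ofReal_pow (norm_nonneg _), Real.norm_eq_abs, sq_abs, sq]
  rw [← ofReal_norm x, ← ENNReal.ofReal_pow (norm_nonneg _), ← h.tsum_eq]
  simp_rw [h2]
  have h3 : ∀ i, inner ℝ x (u i) = c i := fun i => by
    rw [real_inner_comm, inner_of_hasSum_smul hu hx]
  simp only [h3] at h ⊢
  exact ENNReal.ofReal_tsum_of_nonneg (fun _ => mul_self_nonneg _) h.summable

theorem hasSum_tsum_inner_smul [CompleteSpace E] (hu : Orthonormal ℝ u) (x : E) :
    HasSum (fun i => inner ℝ (u i) x • u i) (∑' i, inner ℝ (u i) x • u i) :=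
  (summable_smul_of_summable_sq hu (summable_inner_sq hu x)).hasSum

theorem inner_sub_tsum_inner_smul [CompleteSpace E] (hu : Orthonormal ℝ u) (x : E) (i : ι) :
    inner ℝ (u i) (x - ∑' j, inner ℝ (u j) x • u j) = 0 := by
  rw [inner_sub_right, inner_of_hasSum_smul hu (hasSum_tsum_inner_smul hu x), sub_self]

theorem inner_tsum_eq_zero {c : ι → ℝ} {p z : E} (hp : HasSum (fun i => c i • u i) p)
    (hz : ∀ i, inner ℝ (u i) z = 0) : inner ℝ z p = 0 := by
  have h := (innerSL ℝ z).hasSum hp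
  simp only [innerSL_apply_apply, inner_smul_right] at h
  have h3 : ∀ i, inner ℝ z (u i) = 0 := fun i => by rw [real_inner_comm, hz]
  simp only [h3, mul_zero] at h
  exact h.unique hasSum_zero

end Hilbert

/-! ### Singular systems of bounded operators. -/

/-- A bounded operator `A` together with a singular system: `A A†` has the eigenvalues `μ i` with
orthonormal eigenvectors `A (e i)`, `√(μ i) e i` is orthonormal, and every vector orthogonal
to all `A (e i)` is annihilated by `A†`. -/
structure IsSingularSystem {H E ι : Type*} [NormedAddCommGroup H] [InnerProductSpace ℝ H]
    [CompleteSpace H] [NormedAddCommGroup E] [InnerProductSpace ℝ E] [CompleteSpace E]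
    (A : H →L[ℝ] E) (μ : ι → ℝ) (e : ι → H) : Prop where
  pos : ∀ i, 0 < μ i
  orthonormal_map : Orthonormal ℝ fun i => A (e i)
  orthonormal_sqrt : Orthonormal ℝ fun i => √(μ i) • e i
  eigen : ∀ i, A (ContinuousLinearMap.adjoint A (A (e i))) = μ i • A (e i)
  complete : ∀ z, (∀ i, inner ℝ (A (e i)) z = 0) → ContinuousLinearMap.adjoint A z = 0

namespace IsSingularSystem

variable {H E ι : Type*} [NormedAddCommGroup H] [InnerProductSpace ℝ H]
    [CompleteSpace H] [NormedAddCommGroup E] [InnerProductSpace ℝ E] [CompleteSpace E]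
    {A : H →L[ℝ] E} {μ : ι → ℝ} {e : ι → H}

theorem inner_map_eq_zero (h : IsSingularSystem A μ e) {z : E}
    (hz : ∀ i, inner ℝ (A (e i)) z = 0) (f : H) : inner ℝ z (A f) = 0 := by
  rw [← ContinuousLinearMap.adjoint_inner_left, h.complete z hz, inner_zero_left]

/-- The residual `A f - p` is orthogonal to the range of `A` by completeness and to `p` by
construction, hence to itself. -/
theorem hasSum_map (h : IsSingularSystem A μ e) (f : H) :
    HasSum (fun i => inner ℝ (A (e i)) (A f) • A (e i)) (A f) := by
  have hp := hasSum_tsum_inner_smul h.orthonormal_map (A f)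
  have hz := inner_sub_tsum_inner_smul h.orthonormal_map (A f)
  set p := ∑' j, inner ℝ (A (e j)) (A f) • A (e j)
  have h0 : inner ℝ (A f - p) (A f - p) = 0 := by
    rw [inner_sub_right, h.inner_map_eq_zero hz, inner_tsum_eq_zero hp hz, sub_zero]
  rw [sub_eq_zero.1 (inner_self_eq_zero.1 h0)] at hp ⊢
  exact hp

/-- The eigenvalue equation only determines `w = A† A (e i)` modulo the kernel of `A`. Since `w` is
orthogonal to that kernel, the squared norm of `w - μ i • e i` reduces to `-μ i (1 - μ i ‖e i‖²)`,
which vanishes because `√(μ i) • e i` is a unit vector. -/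
theorem adjoint_map (h : IsSingularSystem A μ e) (i : ι) :
    ContinuousLinearMap.adjoint A (A (e i)) = μ i • e i := by
  set w := ContinuousLinearMap.adjoint A (A (e i)) with hw
  have hA : A (w - μ i • e i) = 0 := by
    rw [map_sub, map_smul, h.eigen, sub_self]
  have hwz : inner ℝ w (w - μ i • e i) = 0 := by
    rw [hw, ContinuousLinearMap.adjoint_inner_left, ← hw, hA, inner_zero_right]
  have hAe : ‖A (e i)‖ = 1 := h.orthonormal_map.1 i
  have hwe : inner ℝ w (e i) = 1 := by
    rw [hw, ContinuousLinearMap.adjoint_inner_left, real_inner_self_eq_norm_sq, hAe]; norm_num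
  have hee : μ i * inner ℝ (e i) (e i) = 1 := by
    have := h.orthonormal_sqrt.1 i
    rw [norm_smul, Real.norm_of_nonneg (Real.sqrt_nonneg _)] at this
    rw [real_inner_self_eq_norm_sq, ← Real.sq_sqrt (h.pos i).le, ← mul_pow, this, one_pow]
  have h0 : inner ℝ (w - μ i • e i) (w - μ i • e i) = 0 := by
    rw [inner_sub_left, hwz, inner_smul_left, inner_sub_right, inner_smul_right, real_inner_comm,
      hwe, hee]
    simp
  exact sub_eq_zero.1 (inner_self_eq_zero.1 h0)

theorem inner_map_map (h : IsSingularSystem A μ e) (i : ι) (f : H) :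
    inner ℝ (A (e i)) (A f) = √(μ i) * inner ℝ (√(μ i) • e i) f := by
  rw [← ContinuousLinearMap.adjoint_inner_left, h.adjoint_map, inner_smul_left, inner_smul_left,
    ← mul_assoc]
  simp [Real.mul_self_sqrt (h.pos i).le]

end IsSingularSystem

/-! ### The embedding operator has a singular system. -/

section Eigensystem
variable {X : Type*} [MeasurableSpace X] {ν : Measure X}
  {H : Type*} [NormedAddCommGroup H] [InnerProductSpace ℝ H] [CompleteSpace H] [RKHS ℝ H X ℝ]

/-- Completeness is the spectral theorem: `z` is orthogonal to all eigenspaces for nonzero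
eigenvalues, so `T z` is orthogonal to every eigenspace of the compact symmetric operator `T = A
A†`. Hence `T z = 0` and `‖A† z‖² = ⟨z, T z⟩ = 0`. -/
theorem isSingularSystem_embeddingOp {h : IsCompactlyEmbedded H ν} {ι : Type*} {μ : ι → ℝ}
    {e : ι → H} (hs : IsEigensystem h μ e) : IsSingularSystem (embeddingOp h) μ e where
  pos := hs.pos
  orthonormal_map := hs.orthonormal_class
  orthonormal_sqrt := hs.orthonormal_sqrt
  eigen := hs.eigen
  complete z hz := by
    have hcomp : IsCompactOperator (integralOp h) :=
      (show IsCompactOperator (embeddingOp h) from h.compact).comp_clm _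
    have hsymm : (integralOp h : Lp ℝ 2 ν →ₗ[ℝ] Lp ℝ 2 ν).IsSymmetric := by
      intro x y
      simp only [integralOp, ContinuousLinearMap.coe_coe, ContinuousLinearMap.comp_apply]
      rw [← ContinuousLinearMap.adjoint_inner_right, ContinuousLinearMap.adjoint_inner_left]
    have hbot := ContinuousLinearMap.orthogonalComplement_iSup_eigenspaces_eq_bot hcomp hsymm
    have hTz : integralOp h z = 0 := by
      rw [← Submodule.mem_bot ℝ, ← hbot, Submodule.mem_orthogonal]
      intro v hv
      induction hv using Submodule.iSup_induction' with
      | zero => exact inner_zero_left _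
      | add x y _ _ hx hy => rw [inner_add_left, hx, hy, add_zero]
      | mem c v hv =>
        have hTv : integralOp h v = c • v := Module.End.mem_eigenspace_iff.1 hv
        have hsw : inner ℝ v (integralOp h z) = inner ℝ (integralOp h v) z := (hsymm v z).symm
        rw [hsw, hTv, inner_smul_left]
        rcases eq_or_ne c 0 with rfl | hc
        · simp
        · have hvz : inner ℝ v z = 0 := by
            have := hs.exhausts c hc v hTv
            clear hsw hTv hv
            induction this using Submodule.span_induction with
            | zero => exact inner_zero_left _
            | add x y _ _ hx hy => rw [inner_add_left, hx, hy, add_zero]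
            | smul a x _ hx => rw [inner_smul_left, hx, mul_zero]
            | mem x hx => obtain ⟨i, -, rfl⟩ := hx; exact hz i
          rw [hvz, mul_zero]
    have : inner ℝ (ContinuousLinearMap.adjoint (embeddingOp h) z)
        (ContinuousLinearMap.adjoint (embeddingOp h) z) = 0 := by
      rw [ContinuousLinearMap.adjoint_inner_left]
      change inner ℝ z (integralOp h z) = 0
      rw [hTz, inner_zero_right]
    exact inner_self_eq_zero.1 this

end Eigensystem

/-! ### Weighted norms on the half-line and dilations. -/

/-- The weighted `L^r` norm of `t ↦ t^(-θ) F(t)` on `(0, ∞)` with respect to `dt / t`. -/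
noncomputable def weightedNorm (θ : ℝ) (r : ℝ≥0∞) (F : ℝ → ℝ≥0∞) : ℝ≥0∞ :=
  if r = ∞ then ⨆ t ∈ Set.Ioi (0 : ℝ), ENNReal.ofReal (t ^ (-θ)) * F t
  else (∫⁻ t in Set.Ioi (0 : ℝ),
    ENNReal.ofReal (t ^ (-θ * r.toReal - 1)) * F t ^ r.toReal) ^ (1 / r.toReal)

/-- Jensen's inequality for infinite weighted sums. -/
theorem tsum_mul_rpow_le {ι : Type*} (w b : ι → ℝ≥0∞) {p : ℝ} (hp : 1 ≤ p) :
    (∑' n, w n * b n) ^ p ≤ (∑' n, w n) ^ (p - 1) * ∑' n, w n * b n ^ p := by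
  have hp0 : 0 < p := by linarith
  have h : ∑' n, w n * b n ≤ (∑' n, w n) ^ (1 - p⁻¹) * (∑' n, w n * b n ^ p) ^ p⁻¹ := by
    rw [ENNReal.tsum_eq_iSup_sum]
    refine iSup_le fun s => (ENNReal.inner_le_weight_mul_Lp_of_nonneg s hp w b).trans ?_
    gcongr
    · rw [sub_nonneg]; exact inv_le_one_of_one_le₀ hp
    · exact ENNReal.sum_le_tsum s
    · exact ENNReal.sum_le_tsum s
  calc _ ≤ ((∑' n, w n) ^ (1 - p⁻¹) * (∑' n, w n * b n ^ p) ^ p⁻¹) ^ p := by gcongr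
    _ = _ := by
      rw [ENNReal.mul_rpow_of_nonneg _ _ hp0.le, ← ENNReal.rpow_mul, ← ENNReal.rpow_mul,
        inv_mul_cancel₀ hp0.ne', ENNReal.rpow_one, sub_mul, inv_mul_cancel₀ hp0.ne', one_mul]

theorem setLIntegral_Ioi_comp_mul_left {g : ℝ → ℝ≥0∞} (hg : Measurable g) {a : ℝ} (ha : 0 < a) :
    ∫⁻ t in Set.Ioi (0 : ℝ), ENNReal.ofReal a * g (a * t) = ∫⁻ t in Set.Ioi (0 : ℝ), g t := by
  conv_rhs => rw [← Real.smul_map_volume_mul_left ha.ne']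
  rw [Measure.restrict_smul, lintegral_smul_measure,
    setLIntegral_map measurableSet_Ioi hg (measurable_const_mul a), abs_of_pos ha,
    lintegral_const_mul _ (show Measurable fun t => g (a * t) from hg.comp (measurable_const_mul a)),
    smul_eq_mul]
  congr 3
  ext t
  simp [ha]

/-- The measure `dt / t` is invariant under dilations, and `a^(-β)` compensates the change in
`t^(-β)`. -/
theorem setLIntegral_weight_dilate (β p : ℝ) (hp : 0 < p) {F : ℝ → ℝ≥0∞} (hF : Measurable F)
    {a : ℝ} (ha : 0 < a) :
    ∫⁻ t in Set.Ioi (0 : ℝ), ENNReal.ofReal (t ^ (-β * p - 1)) *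
        (ENNReal.ofReal (a ^ (-β)) * F (a * t)) ^ p =
      ∫⁻ t in Set.Ioi (0 : ℝ), ENNReal.ofReal (t ^ (-β * p - 1)) * F t ^ p := by
  have hm : Measurable fun t : ℝ => ENNReal.ofReal (t ^ (-β * p - 1)) * F t ^ p := by fun_prop
  rw [← setLIntegral_Ioi_comp_mul_left hm ha]
  refine setLIntegral_congr_fun measurableSet_Ioi fun t ht => ?_
  have ht : 0 < t := ht
  rw [ENNReal.mul_rpow_of_nonneg _ _ hp.le, ENNReal.ofReal_rpow_of_pos (by positivity), ← mul_assoc,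
    ← mul_assoc, ← ENNReal.ofReal_mul (by positivity), ← ENNReal.ofReal_mul (by positivity)]
  congr 2
  rw [Real.mul_rpow ha.le ht.le, ← Real.rpow_mul ha.le, Real.rpow_sub_one ha.ne']
  field_simp

/-- A function dominated by a weighted sum of dilates of `F` has weighted norm dominated by that
of `F`. -/
theorem weightedNorm_le_of_le_tsum_dilate {ι : Type*} [Countable ι] {β θ : ℝ} {r : ℝ≥0∞}
    (hr : 1 ≤ r) {F G : ℝ → ℝ≥0∞} (hF : Measurable F) (c : ℝ≥0∞) (α : ι → ℝ≥0∞) {a : ι → ℝ}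
    (ha : ∀ n, 0 < a n)
    (h : ∀ t, 0 < t → G t ≤ c * ENNReal.ofReal (t ^ (θ - β)) *
      ∑' n, α n * (ENNReal.ofReal (a n ^ (-β)) * F (a n * t))) :
    weightedNorm θ r G ≤ c * (∑' n, α n) * weightedNorm β r F := by
  by_cases hr' : r = ∞
  · simp only [weightedNorm, hr', if_true]
    refine iSup₂_le fun t ht => ?_
    have ht : 0 < t := ht
    calc _ ≤ ENNReal.ofReal (t ^ (-θ)) * (c * ENNReal.ofReal (t ^ (θ - β)) *
            ∑' n, α n * (ENNReal.ofReal (a n ^ (-β)) * F (a n * t))) := by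
          gcongr; exact h t ht
      _ = c * ∑' n, α n * (ENNReal.ofReal ((a n * t) ^ (-β)) * F (a n * t)) := by
          have h1 : ENNReal.ofReal (t ^ (-θ)) * ENNReal.ofReal (t ^ (θ - β)) =
              ENNReal.ofReal (t ^ (-β)) := by
            rw [← ENNReal.ofReal_mul (by positivity), ← Real.rpow_add ht]; congr 2; ring
          rw [mul_assoc c, mul_left_comm, ← mul_assoc (ENNReal.ofReal (t ^ (-θ))), h1,
            ← ENNReal.tsum_mul_left]
          congr 2; ext n
          rw [Real.mul_rpow (ha n).le ht.le, ENNReal.ofReal_mul (by have := ha n; positivity)]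
          ring
      _ ≤ c * ∑' n, α n * ⨆ t ∈ Set.Ioi (0 : ℝ), ENNReal.ofReal (t ^ (-β)) * F t := by
          gcongr with n
          exact le_iSup₂ (f := fun t (_ : t ∈ Set.Ioi (0 : ℝ)) => ENNReal.ofReal (t ^ (-β)) * F t)
            (a n * t) (mul_pos (ha n) ht)
      _ = _ := by rw [ENNReal.tsum_mul_right, mul_assoc]
  · simp only [weightedNorm, hr', if_false]
    set p := r.toReal with hp
    have hp1 : 1 ≤ p := by
      rw [hp, ← ENNReal.toReal_one]; exact ENNReal.toReal_mono hr' hr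
    have hp0 : 0 < p := by linarith
    set S := ∑' n, α n
    set J := ∫⁻ t in Set.Ioi (0 : ℝ), ENNReal.ofReal (t ^ (-β * p - 1)) * F t ^ p with hJ
    rw [one_div, ENNReal.rpow_inv_le_iff hp0, ENNReal.mul_rpow_of_nonneg _ _ hp0.le,
      ENNReal.rpow_inv_rpow hp0.ne', ENNReal.mul_rpow_of_nonneg _ _ hp0.le]
    have hFn : ∀ n, Measurable fun t => F (a n * t) := fun n => hF.comp (measurable_const_mul (a n))
    have hterm : ∀ n, Measurable fun t : ℝ => ENNReal.ofReal (t ^ (-β * p - 1)) *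
        (ENNReal.ofReal (a n ^ (-β)) * F (a n * t)) ^ p := fun n => by
      have := hFn n; fun_prop
    calc _ ≤ ∫⁻ t in Set.Ioi (0 : ℝ), c ^ p * S ^ (p - 1) * ∑' n, α n *
            (ENNReal.ofReal (t ^ (-β * p - 1)) *
              (ENNReal.ofReal (a n ^ (-β)) * F (a n * t)) ^ p) := by
          refine setLIntegral_mono' measurableSet_Ioi fun t ht => ?_
          have ht : 0 < t := ht
          have h1 : ENNReal.ofReal (t ^ (-θ * p - 1)) * ENNReal.ofReal (t ^ (θ - β)) ^ p =
              ENNReal.ofReal (t ^ (-β * p - 1)) := by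
            rw [ENNReal.ofReal_rpow_of_pos (by positivity), ← ENNReal.ofReal_mul (by positivity),
              ← Real.rpow_mul ht.le, ← Real.rpow_add ht]
            congr 2; ring
          calc _ ≤ ENNReal.ofReal (t ^ (-θ * p - 1)) * (c * ENNReal.ofReal (t ^ (θ - β)) *
                ∑' n, α n * (ENNReal.ofReal (a n ^ (-β)) * F (a n * t))) ^ p := by
                gcongr; exact h t ht
            _ = c ^ p * ENNReal.ofReal (t ^ (-β * p - 1)) *
                (∑' n, α n * (ENNReal.ofReal (a n ^ (-β)) * F (a n * t))) ^ p := by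
                rw [ENNReal.mul_rpow_of_nonneg _ _ hp0.le, ENNReal.mul_rpow_of_nonneg _ _ hp0.le,
                  ← h1]; ring
            _ ≤ c ^ p * ENNReal.ofReal (t ^ (-β * p - 1)) * (S ^ (p - 1) *
                ∑' n, α n * (ENNReal.ofReal (a n ^ (-β)) * F (a n * t)) ^ p) := by
                gcongr; exact tsum_mul_rpow_le _ _ hp1
            _ = _ := by
                simp_rw [mul_left_comm (α _) (ENNReal.ofReal (t ^ (-β * p - 1)))]
                rw [ENNReal.tsum_mul_left]; ring
      _ = c ^ p * S ^ (p - 1) * ∑' n, α n * J := by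
          rw [lintegral_const_mul _ (Measurable.tsum fun n => (hterm n).const_mul _),
            lintegral_tsum fun n => ((hterm n).const_mul _).aemeasurable]
          congr 2; ext n
          rw [lintegral_const_mul _ (hterm n), setLIntegral_weight_dilate β p hp0 hF (ha n)]
      _ = _ := by
          rw [ENNReal.tsum_mul_right, ← mul_assoc, mul_assoc (c ^ p)]
          congr 2
          -- Both exponents `p - 1` and `1` are nonnegative, so they may be added even if the sum of
          -- the weights is `0` or `∞`.
          conv_lhs => rw [← ENNReal.rpow_one (∑' n, α n)]
          rw [← ENNReal.rpow_add_of_nonneg _ _ (by linarith) zero_le_one, sub_add_cancel]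

/-- A function of finite weighted norm has no positive constant lower bound. -/
theorem eq_zero_of_weightedNorm_lt_top {β : ℝ} (hβ : 0 < β) {r : ℝ≥0∞} (hr : 1 ≤ r)
    {F : ℝ → ℝ≥0∞} (hfin : weightedNorm β r F < ∞) {b : ℝ≥0∞}
    (hb : ∀ t, 0 < t → b ≤ F t) : b = 0 := by
  by_contra hb0
  refine hfin.ne ?_
  by_cases hr' : r = ∞
  · simp only [weightedNorm, hr', if_true]
    rw [eq_top_iff]
    have hlim : Filter.Tendsto (fun t : ℝ => ENNReal.ofReal (t ^ (-β)) * b) (𝓝[>] 0) (𝓝 ∞) := by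
      have h1 : Filter.Tendsto (fun t : ℝ => ENNReal.ofReal (t ^ (-β))) (𝓝[>] 0) (𝓝 ∞) :=
        ENNReal.tendsto_ofReal_atTop.comp (tendsto_rpow_neg_nhdsGT_zero (neg_lt_zero.2 hβ))
      have := ENNReal.Tendsto.mul_const (b := b) h1 (Or.inl ENNReal.top_ne_zero)
      rwa [ENNReal.top_mul hb0] at this
    refine le_of_tendsto hlim ?_
    filter_upwards [self_mem_nhdsWithin] with t ht
    exact le_trans (by gcongr; exact hb t ht) (le_iSup₂
      (f := fun t (_ : t ∈ Set.Ioi (0 : ℝ)) => ENNReal.ofReal (t ^ (-β)) * F t) t ht)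
  · simp only [weightedNorm, hr', if_false]
    set p := r.toReal with hp
    have hp1 : 1 ≤ p := by
      rw [hp, ← ENNReal.toReal_one]; exact ENNReal.toReal_mono hr' hr
    have hp0 : 0 < p := by linarith
    suffices h : ∫⁻ t in Set.Ioi (0 : ℝ), ENNReal.ofReal (t ^ (-β * p - 1)) * F t ^ p = ∞ by
      rw [h, ENNReal.top_rpow_of_pos (by positivity)]
    -- No power of `t` is integrable over the whole half-line.
    have hw : ∫⁻ t in Set.Ioi (0 : ℝ), ENNReal.ofReal (t ^ (-β * p - 1)) = ∞ := by
      by_contra hne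
      refine not_integrableOn_Ioi_rpow (-β * p - 1) ⟨by fun_prop, ?_⟩
      rw [hasFiniteIntegral_iff_ofReal]
      · exact lt_top_iff_ne_top.2 hne
      · filter_upwards [ae_restrict_mem measurableSet_Ioi] with t ht
        exact Real.rpow_nonneg (le_of_lt ht) _
    rw [eq_top_iff]
    calc ∞ = (∫⁻ t in Set.Ioi (0 : ℝ), ENNReal.ofReal (t ^ (-β * p - 1))) * b ^ p := by
          rw [hw, ENNReal.top_mul]
          simp [hb0, hp0.le, hp0]
      _ = ∫⁻ t in Set.Ioi (0 : ℝ), ENNReal.ofReal (t ^ (-β * p - 1)) * b ^ p := by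
          rw [lintegral_mul_const _ (by fun_prop)]
      _ ≤ _ := by
          refine setLIntegral_mono' measurableSet_Ioi fun t ht => ?_
          gcongr
          exact hb t ht

/-! ### The K-functional as a weighted square sum. -/

/-- The norm that the range of `A` inherits from the domain of `A` as a quotient. -/
noncomputable def rangeNorm {H E : Type*} [NormedAddCommGroup H] [InnerProductSpace ℝ H]
    [NormedAddCommGroup E] [InnerProductSpace ℝ E] (A : H →L[ℝ] E) (u : E) : ℝ≥0∞ :=
  ⨅ (f : H) (_ : A f = u), ‖f‖ₑ

/-- The weighted square sum equivalent to the square of the K-functional. -/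
noncomputable def quadFunctional {ι : Type*} (μ a : ι → ℝ) (t : ℝ) : ℝ≥0∞ :=
  ∑' i, ‖a i‖ₑ ^ 2 * ENNReal.ofReal (min 1 (t ^ 2 / μ i))

theorem enorm_sq_eq_ofReal (a : ℝ) : ‖a‖ₑ ^ 2 = ENNReal.ofReal (a ^ 2) := by
  rw [← ofReal_norm, ← ENNReal.ofReal_pow (norm_nonneg _), Real.norm_eq_abs, sq_abs]

theorem add_sq_le_two_mul (a b : ℝ≥0∞) : (a + b) ^ 2 ≤ 2 * (a ^ 2 + b ^ 2) := by
  have := ENNReal.rpow_add_le_mul_rpow_add_rpow a b (p := 2) one_le_two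
  norm_num at this
  exact_mod_cast this

theorem add_sq_ge (a b : ℝ≥0∞) : a ^ 2 + b ^ 2 ≤ (a + b) ^ 2 := by
  calc a ^ 2 + b ^ 2 ≤ a ^ 2 + b ^ 2 + 2 * a * b := le_self_add
    _ = _ := by ring

theorem tsum_sq_le_sq_tsum {ι : Type*} (p : ι → ℝ≥0∞) : ∑' n, p n ^ 2 ≤ (∑' n, p n) ^ 2 := by
  calc _ ≤ ∑' n, p n * ∑' m, p m := by
        refine ENNReal.tsum_le_tsum fun n => ?_
        rw [sq]; gcongr; exact ENNReal.le_tsum n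
    _ = _ := by rw [ENNReal.tsum_mul_right, sq]

theorem monotone_kFunctional {E : Type*} [NormedAddCommGroup E] (S : Set E) (N : E → ℝ≥0∞) (x : E) :
    Monotone (kFunctional S N x) := by
  intro s t hst
  unfold kFunctional
  gcongr

section RangeNorm

variable {H E : Type*} [NormedAddCommGroup H] [InnerProductSpace ℝ H]
    [NormedAddCommGroup E] [InnerProductSpace ℝ E] {A : H →L[ℝ] E}

theorem kFunctional_range_le (x : E) (t : ℝ) (f : H) :
    kFunctional (Set.range A) (rangeNorm A) x t ≤ ‖x - A f‖ₑ + ENNReal.ofReal t * ‖f‖ₑ := by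
  calc _ ≤ ‖x - A f‖ₑ + ENNReal.ofReal t * rangeNorm A (A f) :=
        iInf₂_le (f := fun y (_ : y ∈ Set.range A) => ‖x - y‖ₑ + ENNReal.ofReal t * rangeNorm A y)
          (A f) ⟨f, rfl⟩
    _ ≤ _ := by
        gcongr
        exact iInf₂_le (f := fun (g : H) (_ : A g = A f) => ‖g‖ₑ) f rfl

/-- With `kFunctional_range_le`, this replaces the infimum over classes and quotient norms by one
infimum over `H`. Positivity of `t` lets multiplication by `t` pass through the infima, including
the empty one with value `∞`. -/
theorem le_kFunctional_range {x : E} {t : ℝ} (ht : 0 < t) {b : ℝ≥0∞}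
    (hb : ∀ f : H, b ≤ ‖x - A f‖ₑ + ENNReal.ofReal t * ‖f‖ₑ) :
    b ≤ kFunctional (Set.range A) (rangeNorm A) x t := by
  refine le_iInf₂ fun y _ => ?_
  have ht' : ENNReal.ofReal t ≠ 0 := by simpa using ht
  rw [rangeNorm, ENNReal.mul_iInf_of_ne ht' ENNReal.ofReal_ne_top, ENNReal.add_iInf]
  refine le_iInf fun f => ?_
  rw [ENNReal.mul_iInf_of_ne ht' ENNReal.ofReal_ne_top, ENNReal.add_iInf]
  refine le_iInf fun hf => ?_
  rw [← hf]
  exact hb f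

end RangeNorm

namespace IsSingularSystem

variable {H E ι : Type*} [NormedAddCommGroup H] [InnerProductSpace ℝ H]
    [CompleteSpace H] [NormedAddCommGroup E] [InnerProductSpace ℝ E] [CompleteSpace E]
    {A : H →L[ℝ] E} {μ : ι → ℝ} {e : ι → H}

/-- For each competitor `f`, split the coefficient of `x` into those of `x - A f` and `A f`. The
weight is at most `1` on the first and at most `t² / μ i` on the second. Bessel's inequality, in `E`
and in `H`, then sums the two parts. -/
theorem quadFunctional_le (h : IsSingularSystem A μ e) (x : E) {t : ℝ} (ht : 0 < t) :
    quadFunctional μ (fun i => inner ℝ (A (e i)) x) t ≤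
      2 * kFunctional (Set.range A) (rangeNorm A) x t ^ 2 := by
  have key : ∀ f : H, quadFunctional μ (fun i => inner ℝ (A (e i)) x) t ≤
      2 * (‖x - A f‖ₑ + ENNReal.ofReal t * ‖f‖ₑ) ^ 2 := by
    intro f
    calc _ ≤ ∑' i, 2 * (‖inner ℝ (A (e i)) (x - A f)‖ₑ ^ 2 +
          ENNReal.ofReal t ^ 2 * ‖inner ℝ (√(μ i) • e i) f‖ₑ ^ 2) := by
          refine ENNReal.tsum_le_tsum fun i => ?_
          have hi := h.pos i
          rw [inner_sub_right, h.inner_map_map, enorm_sq_eq_ofReal, enorm_sq_eq_ofReal,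
            enorm_sq_eq_ofReal, ← ENNReal.ofReal_pow ht.le, ← ENNReal.ofReal_mul (by positivity),
            ← ENNReal.ofReal_mul (by positivity), ← ENNReal.ofReal_add (by positivity)
            (by positivity), ← ENNReal.ofReal_ofNat, ← ENNReal.ofReal_mul (by positivity)]
          refine ENNReal.ofReal_le_ofReal ?_
          set a := inner ℝ (A (e i)) x
          set c := inner ℝ (√(μ i) • e i) f
          have hs : √(μ i) ^ 2 = μ i := Real.sq_sqrt hi.le
          set m := min 1 (t ^ 2 / μ i) with hm
          have hm1 : m ≤ 1 := min_le_left _ _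
          have hm0 : 0 ≤ m := by positivity
          have hm2 : m * μ i ≤ t ^ 2 := by
            rw [← le_div_iff₀ hi]; exact min_le_right _ _
          have e1 : a ^ 2 ≤ 2 * ((a - √(μ i) * c) ^ 2 + μ i * c ^ 2) := by
            have : μ i * c ^ 2 = (√(μ i) * c) ^ 2 := by rw [mul_pow, hs]
            rw [this]; nlinarith [sq_nonneg (a - 2 * (√(μ i) * c))]
          calc a ^ 2 * m ≤ 2 * ((a - √(μ i) * c) ^ 2 + μ i * c ^ 2) * m := by gcongr
            _ = 2 * ((a - √(μ i) * c) ^ 2 * m + (m * μ i) * c ^ 2) := by ring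
            _ ≤ 2 * ((a - √(μ i) * c) ^ 2 * 1 + t ^ 2 * c ^ 2) := by gcongr
            _ = _ := by rw [mul_one]
      _ ≤ 2 * (‖x - A f‖ₑ ^ 2 + ENNReal.ofReal t ^ 2 * ‖f‖ₑ ^ 2) := by
          rw [ENNReal.tsum_mul_left, ENNReal.tsum_add, ENNReal.tsum_mul_left]
          gcongr
          · exact tsum_enorm_inner_sq_le h.orthonormal_map _
          · exact tsum_enorm_inner_sq_le h.orthonormal_sqrt _
      _ ≤ _ := by
          rw [← mul_pow]; gcongr; exact add_sq_ge _ _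
  set Q := quadFunctional μ (fun i => inner ℝ (A (e i)) x) t
  have hK : (Q / 2) ^ (2⁻¹ : ℝ) ≤ kFunctional (Set.range A) (rangeNorm A) x t := by
    refine le_kFunctional_range ht fun f => ?_
    rw [ENNReal.rpow_inv_le_iff two_pos, ENNReal.rpow_two]
    exact ENNReal.div_le_of_le_mul' (key f)
  rw [ENNReal.rpow_inv_le_iff two_pos, ENNReal.rpow_two] at hK
  rwa [ENNReal.div_le_iff_le_mul (by simp) (by simp), mul_comm] at hK

theorem summable_smul_of_summable_sq (h : IsSingularSystem A μ e) {c : ι → ℝ}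
    (hc : Summable fun i => c i ^ 2) : Summable fun i => (c i * √(μ i)) • e i := by
  simpa [mul_smul] using SpectralRegularisation.summable_smul_of_summable_sq h.orthonormal_sqrt hc

/-- The competitor is a spectral cut-off, keeping exactly the coefficients with `μ i > t²`. Its two
squared costs add up to the quadratic functional exactly; the factor 2 comes from squaring a sum. -/
theorem kFunctional_sq_le (h : IsSingularSystem A μ e) {y : E}
    (hy : HasSum (fun i => inner ℝ (A (e i)) y • A (e i)) y) {t : ℝ} (ht : 0 < t) :
    kFunctional (Set.range A) (rangeNorm A) y t ^ 2 ≤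
      2 * quadFunctional μ (fun i => inner ℝ (A (e i)) y) t := by
  classical
  set b : ι → ℝ := fun i => inner ℝ (A (e i)) y with hb
  set c : ι → ℝ := fun i => if t ^ 2 < μ i then b i / √(μ i) else 0 with hc
  have hcs : Summable fun i => c i ^ 2 := by
    refine Summable.of_nonneg_of_le (fun _ => sq_nonneg _) (fun i => ?_)
      ((summable_inner_sq h.orthonormal_map y).mul_left (t ^ 2)⁻¹)
    have hi := h.pos i
    simp only [hc]
    split_ifs with hlt
    · rw [div_pow, Real.sq_sqrt hi.le, div_eq_inv_mul]
      gcongr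
    · simp only [ne_eq, OfNat.ofNat_ne_zero, not_false_eq_true, zero_pow]; positivity
  have hf := (SpectralRegularisation.summable_smul_of_summable_sq h.orthonormal_sqrt hcs).hasSum
  set f := ∑' i, c i • √(μ i) • e i
  have hAf : HasSum (fun i => (c i * √(μ i)) • A (e i)) (A f) := by
    simpa [Function.comp_def, mul_smul] using A.hasSum hf
  have hd : HasSum (fun i => (b i - c i * √(μ i)) • A (e i)) (y - A f) := by
    simpa only [sub_smul] using hy.sub hAf
  calc _ ≤ (‖y - A f‖ₑ + ENNReal.ofReal t * ‖f‖ₑ) ^ 2 := by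
        gcongr; exact kFunctional_range_le y t f
    _ ≤ 2 * (‖y - A f‖ₑ ^ 2 + (ENNReal.ofReal t * ‖f‖ₑ) ^ 2) := add_sq_le_two_mul _ _
    _ = _ := by
        rw [mul_pow, enorm_sq_eq_tsum h.orthonormal_map hd, enorm_sq_eq_tsum h.orthonormal_sqrt hf,
          ← ENNReal.tsum_mul_left, ← ENNReal.tsum_add, quadFunctional]
        congr 2
        ext i
        have hi := h.pos i
        simp only [enorm_sq_eq_ofReal, hc]
        rw [← ENNReal.ofReal_pow ht.le, ← ENNReal.ofReal_mul (by positivity),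
          ← ENNReal.ofReal_mul (by positivity), ← ENNReal.ofReal_add (by positivity)
          (by positivity)]
        congr 1
        have hs := Real.sq_sqrt hi.le
        split_ifs with hlt
        · rw [min_eq_right ((div_le_one hi).2 hlt.le),
            div_mul_cancel₀ _ (Real.sqrt_pos.2 hi).ne', sub_self, div_pow, hs]
          ring
        · rw [min_eq_left ((one_le_div hi).2 (not_lt.1 hlt))]; ring

end IsSingularSystem

/-! ### The dyadic multiplier estimate. -/

/-- The dyadic weights of the multiplier estimate. -/
noncomputable def dyadicWeight (θ : ℝ) (n : ℤ) : ℝ := ((2 : ℝ) ^ n) ^ θ * min 1 ((2 : ℝ) ^ n)⁻¹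

theorem dyadicWeight_nonneg (θ : ℝ) (n : ℤ) : 0 ≤ dyadicWeight θ n := by
  unfold dyadicWeight; positivity

/-- Geometric decay with ratio `2^(θ - 1)` as `n → ∞` and `2^(-θ)` as `n → -∞`. -/
theorem summable_dyadicWeight {θ : ℝ} (h0 : 0 < θ) (h1 : θ < 1) : Summable (dyadicWeight θ) := by
  refine Summable.of_nat_of_neg ?_ ?_
  · have hs : Summable fun n : ℕ => ((2 : ℝ) ^ (θ - 1)) ^ n :=
      summable_geometric_of_lt_one (by positivity)
        (Real.rpow_lt_one_of_one_lt_of_neg one_lt_two (by linarith))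
    refine Summable.of_nonneg_of_le (fun n => dyadicWeight_nonneg _ _) (fun n => ?_) hs
    calc dyadicWeight θ n ≤ ((2 : ℝ) ^ (n : ℤ)) ^ θ * ((2 : ℝ) ^ (n : ℤ))⁻¹ := by
          unfold dyadicWeight; gcongr; exact min_le_right _ _
      _ = _ := by
          rw [zpow_natCast, ← Real.rpow_natCast, ← Real.rpow_natCast, ← Real.rpow_mul two_pos.le,
            ← Real.rpow_mul two_pos.le, ← Real.rpow_neg two_pos.le, ← Real.rpow_add two_pos]
          congr 1; ring
  · have hs : Summable fun n : ℕ => ((2 : ℝ) ^ (-θ)) ^ n :=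
      summable_geometric_of_lt_one (by positivity)
        (Real.rpow_lt_one_of_one_lt_of_neg one_lt_two (by linarith))
    refine Summable.of_nonneg_of_le (fun n => dyadicWeight_nonneg _ _) (fun n => ?_) hs
    calc dyadicWeight θ (-n) ≤ ((2 : ℝ) ^ (-n : ℤ)) ^ θ * 1 := by
          unfold dyadicWeight; gcongr; exact min_le_left _ _
      _ = _ := by
          rw [mul_one, zpow_neg, zpow_natCast, ← Real.rpow_natCast, ← Real.rpow_natCast,
            ← Real.rpow_neg two_pos.le, ← Real.rpow_mul two_pos.le, ← Real.rpow_mul two_pos.le]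
          congr 1; ring

/-- Take `n = -k` with `2^k ≤ τ < 2^(k+1)`, where `τ = t / √m`. Then `2^n t ≥ √m`, so the last
minimum equals 1, and `m^(θ - β)` is `(t^(θ - β) τ^(β - θ))²`. Replacing `τ` by `2^k` costs a factor
2 in `τ^(β - θ)`, as `β - θ < 1`, and another in `min 1 τ`; squared together they give 16. -/
theorem exists_rpow_mul_min_le {β θ : ℝ} (hβ₁ : β < 1) (hθ₀ : 0 < θ)
    {m t : ℝ} (hm : 0 < m) (ht : 0 < t) :
    ∃ n : ℤ, m ^ (θ - β) * min 1 (t ^ 2 / m) ≤ 16 * (t ^ (θ - β)) ^ 2 *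
      ((dyadicWeight θ n * ((2 : ℝ) ^ n) ^ (-β)) ^ 2 * min 1 (((2 : ℝ) ^ n * t) ^ 2 / m)) := by
  have hsm : 0 < √m := Real.sqrt_pos.2 hm
  have hsq : √m ^ 2 = m := Real.sq_sqrt hm.le
  obtain ⟨k, hk1, hk2⟩ := exists_mem_Ico_zpow (x := t / √m) (y := (2 : ℝ)) (by positivity) one_lt_two
  rw [zpow_add_one₀ two_ne_zero] at hk2
  refine ⟨-k, ?_⟩
  set s := (2 : ℝ) ^ k with hs
  have hs0 : 0 < s := by positivity
  have hsn : (2 : ℝ) ^ (-k) = s⁻¹ := by rw [zpow_neg]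
  obtain ⟨τ, hτ⟩ : ∃ τ, τ = t / √m := ⟨_, rfl⟩
  rw [← hτ] at hk1 hk2
  have hτ0 : 0 < τ := hs0.trans_le hk1
  have htm : √m * τ = t := by rw [hτ]; field_simp
  have hdw : dyadicWeight θ (-k) * ((2 : ℝ) ^ (-k)) ^ (-β) = s ^ (β - θ) * min 1 s := by
    rw [dyadicWeight, hsn, inv_inv, Real.inv_rpow hs0.le, Real.inv_rpow hs0.le,
      ← Real.rpow_neg hs0.le, ← Real.rpow_neg hs0.le, mul_right_comm, ← Real.rpow_add hs0]
    congr 2; ring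
  have e1 : min 1 (((2 : ℝ) ^ (-k) * t) ^ 2 / m) = 1 := by
    refine min_eq_left ?_
    have h1 : 1 ≤ s⁻¹ * τ := by rwa [← div_eq_inv_mul, one_le_div hs0]
    rw [hsn, ← htm, one_le_div hm, mul_left_comm, mul_pow, hsq]
    exact le_mul_of_one_le_right hm.le (one_le_pow₀ h1)
  have e2 : t ^ 2 / m = τ ^ 2 := by rw [hτ, div_pow, hsq]
  have e3 : m ^ (θ - β) = (t ^ (θ - β)) ^ 2 * (τ ^ (β - θ)) ^ 2 := by
    have e4 : √m ^ (θ - β) = t ^ (θ - β) * τ ^ (β - θ) := by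
      rw [← htm, Real.mul_rpow hsm.le hτ0.le, mul_assoc, ← Real.rpow_add hτ0]; simp
    rw [← mul_pow, ← e4, ← Real.rpow_natCast, ← Real.rpow_mul hsm.le, mul_comm (θ - β),
      Real.rpow_mul hsm.le, Real.rpow_natCast, hsq]
  have e5 : τ ^ (β - θ) ≤ 2 * s ^ (β - θ) := by
    have h1 : (τ / s) ^ (β - θ) ≤ 2 := by
      have h2 : 1 ≤ τ / s := (one_le_div hs0).2 hk1
      calc (τ / s) ^ (β - θ) ≤ (τ / s) ^ (1 : ℝ) :=
            Real.rpow_le_rpow_of_exponent_le h2 (by linarith)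
        _ ≤ 2 := by rw [Real.rpow_one, div_le_iff₀ hs0]; linarith
    rwa [Real.div_rpow hτ0.le hs0.le, div_le_iff₀ (by positivity)] at h1
  have e6 : min 1 (τ ^ 2) ≤ (2 * min 1 s) ^ 2 := by
    rcases le_total 1 s with h | h
    · rw [min_eq_left h]; exact (min_le_left _ _).trans (by norm_num)
    · rw [min_eq_right h]; refine (min_le_right _ _).trans ?_
      gcongr; linarith
  rw [hdw, e1, e2, e3, mul_one]
  calc _ ≤ (t ^ (θ - β)) ^ 2 * (2 * s ^ (β - θ)) ^ 2 * (2 * min 1 s) ^ 2 := by gcongr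
    _ = _ := by ring

/-- Multipliers of size `c μ^((θ - β) / 2)` increase the square functional at most by averaging over
dyadic dilates. -/
theorem quadFunctional_le_tsum {ι : Type*} {μ a b : ι → ℝ} (hμ : ∀ i, 0 < μ i) {β θ : ℝ}
    (hβ₁ : β < 1) (hθ₀ : 0 < θ) {c : ℝ≥0∞}
    (hb : ∀ i, ‖b i‖ₑ ≤ c * ENNReal.ofReal (μ i ^ ((θ - β) / 2)) * ‖a i‖ₑ) {t : ℝ} (ht : 0 < t) :
    quadFunctional μ b t ≤ 16 * c ^ 2 * ENNReal.ofReal (t ^ (θ - β)) ^ 2 *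
      ∑' n : ℤ, (ENNReal.ofReal (dyadicWeight θ n) * ENNReal.ofReal (((2 : ℝ) ^ n) ^ (-β))) ^ 2 *
        quadFunctional μ a ((2 : ℝ) ^ n * t) := by
  unfold quadFunctional
  simp_rw [← ENNReal.tsum_mul_left]
  -- With the sum over `i` outside, each `i` may select its own dyadic scale `n`; the other scales
  -- are discarded.
  rw [ENNReal.tsum_comm]
  refine ENNReal.tsum_le_tsum fun i => ?_
  have hi := hμ i
  obtain ⟨n, hn⟩ := exists_rpow_mul_min_le hβ₁ hθ₀ hi ht
  refine le_trans ?_ (ENNReal.le_tsum n)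
  have hsq : (μ i ^ ((θ - β) / 2)) ^ 2 = μ i ^ (θ - β) := by
    rw [← Real.rpow_natCast, ← Real.rpow_mul hi.le]; congr 1; push_cast; ring
  have hn' := ENNReal.ofReal_le_ofReal hn
  have hd := dyadicWeight_nonneg θ n
  rw [ENNReal.ofReal_mul (by positivity), ENNReal.ofReal_mul (by positivity),
    ENNReal.ofReal_mul (by positivity), ENNReal.ofReal_mul (by positivity),
    ENNReal.ofReal_pow (by positivity), ENNReal.ofReal_pow (by positivity),
    ENNReal.ofReal_mul hd, ENNReal.ofReal_ofNat] at hn'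
  calc _ ≤ (c * ENNReal.ofReal (μ i ^ ((θ - β) / 2)) * ‖a i‖ₑ) ^ 2 *
        ENNReal.ofReal (min 1 (t ^ 2 / μ i)) := by gcongr; exact hb i
    _ = c ^ 2 * ‖a i‖ₑ ^ 2 * (ENNReal.ofReal (μ i ^ (θ - β)) *
        ENNReal.ofReal (min 1 (t ^ 2 / μ i))) := by
        rw [mul_pow, mul_pow, ← ENNReal.ofReal_pow (by positivity), hsq]; ring
    _ ≤ _ := by grw [hn']
    _ = _ := by ring

namespace IsSingularSystem

variable {H E ι : Type*} [NormedAddCommGroup H] [InnerProductSpace ℝ H]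
    [CompleteSpace H] [NormedAddCommGroup E] [InnerProductSpace ℝ E] [CompleteSpace E]
    {A : H →L[ℝ] E} {μ : ι → ℝ} {e : ι → H}

/-- The constant is `8 = √(2 * 16 * 2)`: one factor 2 from each comparison of the K-functional with
the quadratic functional, and 16 from the dyadic estimate. -/
theorem kFunctional_le_tsum (h : IsSingularSystem A μ e) {β θ : ℝ}
    (hβ₁ : β < 1) (hθ₀ : 0 < θ) {x y : E}
    (hy : HasSum (fun i => inner ℝ (A (e i)) y • A (e i)) y) {c : ℝ≥0∞}
    (hc : ∀ i, ‖inner ℝ (A (e i)) y‖ₑ ≤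
      c * ENNReal.ofReal (μ i ^ ((θ - β) / 2)) * ‖inner ℝ (A (e i)) x‖ₑ) {t : ℝ} (ht : 0 < t) :
    kFunctional (Set.range A) (rangeNorm A) y t ≤ 8 * c * ENNReal.ofReal (t ^ (θ - β)) *
      ∑' n : ℤ, ENNReal.ofReal (dyadicWeight θ n) * (ENNReal.ofReal (((2 : ℝ) ^ n) ^ (-β)) *
        kFunctional (Set.range A) (rangeNorm A) x ((2 : ℝ) ^ n * t)) := by
  rw [← (ENNReal.pow_right_strictMono two_ne_zero).le_iff_le]
  calc _ ≤ _ := h.kFunctional_sq_le hy ht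
    _ ≤ 2 * (16 * c ^ 2 * ENNReal.ofReal (t ^ (θ - β)) ^ 2 * ∑' n : ℤ,
        (ENNReal.ofReal (dyadicWeight θ n) * ENNReal.ofReal (((2 : ℝ) ^ n) ^ (-β))) ^ 2 *
          (2 * kFunctional (Set.range A) (rangeNorm A) x ((2 : ℝ) ^ n * t) ^ 2)) := by
        grw [quadFunctional_le_tsum h.pos hβ₁ hθ₀ hc ht]
        gcongr with n
        exact h.quadFunctional_le x (by positivity)
    _ = (8 * c * ENNReal.ofReal (t ^ (θ - β))) ^ 2 * ∑' n : ℤ,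
        (ENNReal.ofReal (dyadicWeight θ n) * (ENNReal.ofReal (((2 : ℝ) ^ n) ^ (-β)) *
          kFunctional (Set.range A) (rangeNorm A) x ((2 : ℝ) ^ n * t))) ^ 2 := by
        simp_rw [mul_left_comm _ (2 : ℝ≥0∞)]
        rw [ENNReal.tsum_mul_left]
        simp_rw [← mul_pow, mul_assoc]
        ring
    _ ≤ _ := by
        rw [mul_pow _ (∑' n : ℤ, _)]
        gcongr
        exact tsum_sq_le_sq_tsum _

theorem interpNorm_le (h : IsSingularSystem A μ e) {β θ : ℝ} {r : ℝ≥0∞}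
    (hβ₁ : β < 1) (hθ₀ : 0 < θ) (hr : 1 ≤ r) {x y : E}
    (hy : HasSum (fun i => inner ℝ (A (e i)) y • A (e i)) y) {c : ℝ≥0∞}
    (hc : ∀ i, ‖inner ℝ (A (e i)) y‖ₑ ≤
      c * ENNReal.ofReal (μ i ^ ((θ - β) / 2)) * ‖inner ℝ (A (e i)) x‖ₑ) :
    interpNorm (Set.range A) (rangeNorm A) θ r y ≤
      8 * c * (∑' n, ENNReal.ofReal (dyadicWeight θ n)) *
        interpNorm (Set.range A) (rangeNorm A) β r x :=
  weightedNorm_le_of_le_tsum_dilate hr (monotone_kFunctional _ _ x).measurable (8 * c) _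
    (a := fun n : ℤ => (2 : ℝ) ^ n) (fun n => by positivity)
    fun _ ht => h.kFunctional_le_tsum hβ₁ hθ₀ hy hc ht

/-- Elements of an interpolation space lie in the closure of the range. -/
theorem hasSum_of_interpNorm_lt_top (h : IsSingularSystem A μ e) {β : ℝ} {r : ℝ≥0∞}
    (hβ₀ : 0 < β) (hr : 1 ≤ r) {x : E}
    (hx : interpNorm (Set.range A) (rangeNorm A) β r x < ∞) :
    HasSum (fun i => inner ℝ (A (e i)) x • A (e i)) x := by
  have hp := hasSum_tsum_inner_smul h.orthonormal_map x
  have hz := inner_sub_tsum_inner_smul h.orthonormal_map x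
  set p := ∑' j, inner ℝ (A (e j)) x • A (e j)
  -- Since `x - p` is orthogonal to the range and to `p`, its norm is at most the distance from `x`
  -- to the range, and so bounds the K-functional below for every `t`.
  have hle : ∀ f : H, ‖x - p‖ ≤ ‖x - A f‖ := by
    intro f
    have h0 : inner ℝ (x - p) (x - A f) = ‖x - p‖ * ‖x - p‖ := by
      rw [inner_sub_right, h.inner_map_eq_zero hz, ← real_inner_self_eq_norm_mul_norm,
        inner_sub_right (x - p) x p, inner_tsum_eq_zero hp hz]
    have h1 := real_inner_le_norm (x - p) (x - A f)
    rw [h0] at h1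
    rcases (norm_nonneg (x - p)).eq_or_lt with h2 | h2
    · rw [← h2]; exact norm_nonneg _
    · exact le_of_mul_le_mul_left h1 h2
  have hzero : ‖x - p‖ₑ = 0 := by
    refine eq_zero_of_weightedNorm_lt_top hβ₀ hr hx fun t ht => ?_
    refine le_kFunctional_range ht fun f => le_trans ?_ le_self_add
    exact enorm_le_iff_norm_le.2 (hle f)
  rw [enorm_eq_zero, sub_eq_zero] at hzero
  rwa [← hzero] at hp

end IsSingularSystem

/-! ### Spectral multipliers and the final estimates. -/

theorem enorm_mul_le_of_ofReal_le {m a ν γ : ℝ} (hν : 0 < ν) {c : ℝ≥0∞}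
    (h : ENNReal.ofReal (|m| * ν ^ γ) ≤ c) :
    ‖m * a‖ₑ ≤ c * ENNReal.ofReal (ν ^ (-γ)) * ‖a‖ₑ := by
  rw [enorm_mul]
  gcongr
  calc ‖m‖ₑ = ENNReal.ofReal (|m| * ν ^ γ) * ENNReal.ofReal (ν ^ (-γ)) := by
        rw [← ENNReal.ofReal_mul (by positivity), mul_assoc, ← Real.rpow_add hν, add_neg_cancel,
          Real.rpow_zero, mul_one, ← Real.norm_eq_abs, ofReal_norm]
    _ ≤ _ := by gcongr

/-- The constant of the multiplier estimate. -/
noncomputable def multiplierConst (θ : ℝ) : ℝ≥0 :=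
  (8 * ∑' n, ENNReal.ofReal (dyadicWeight θ n)).toNNReal

theorem coe_multiplierConst {θ : ℝ} (h0 : 0 < θ) (h1 : θ < 1) :
    (multiplierConst θ : ℝ≥0∞) = 8 * ∑' n, ENNReal.ofReal (dyadicWeight θ n) := by
  refine ENNReal.coe_toNNReal (ENNReal.mul_ne_top (by simp) ?_)
  exact (summable_dyadicWeight h0 h1).tsum_ofReal_ne_top

namespace IsSingularSystem

variable {H E ι : Type*} [NormedAddCommGroup H] [InnerProductSpace ℝ H]
    [CompleteSpace H] [NormedAddCommGroup E] [InnerProductSpace ℝ E] [CompleteSpace E]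
    {A : H →L[ℝ] E} {μ : ι → ℝ} {e : ι → H}

/-- The supremum itself serves as the constant `c`, even if infinite. Separating `s` from `m`
absorbs the sign between the error multiplier `μ g - 1` and the stated `1 - μ g`. -/
theorem interpNorm_le_iSup_mul (h : IsSingularSystem A μ e) {β θ : ℝ} {r : ℝ≥0∞}
    (hβ₁ : β < 1) (hθ₀ : 0 < θ) (hθ₁ : θ < 1) (hr : 1 ≤ r) {x y : E}
    (hy : HasSum (fun i => inner ℝ (A (e i)) y • A (e i)) y) {m : ι → ℝ} {s : ι → ℝ}
    (hs : ∀ i, |s i| = |m i|)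
    (hm : ∀ i, inner ℝ (A (e i)) y = s i * inner ℝ (A (e i)) x) :
    interpNorm (Set.range A) (rangeNorm A) θ r y ≤
      multiplierConst θ * (⨆ i, ENNReal.ofReal (|m i| * μ i ^ ((β - θ) / 2))) *
        interpNorm (Set.range A) (rangeNorm A) β r x := by
  refine (h.interpNorm_le hβ₁ hθ₀ hr (x := x) hy
    (c := ⨆ i, ENNReal.ofReal (|m i| * μ i ^ ((β - θ) / 2))) fun i => ?_).trans_eq ?_
  · rw [hm, show (θ - β) / 2 = -((β - θ) / 2) by ring]
    refine enorm_mul_le_of_ofReal_le (h.pos i) ?_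
    rw [hs]
    exact le_iSup (fun i => ENNReal.ofReal (|m i| * μ i ^ ((β - θ) / 2))) i
  · rw [coe_multiplierConst hθ₀ hθ₁]; ring

/-- Relative to the orthonormal vectors `√(μ i) • e i` the coefficients are `√(μ i) * q i * ⟨x, A (e
i)⟩`, square summable because `μ i ≤ 1` and `q` is bounded. -/
theorem summable_filter_smul (h : IsSingularSystem A μ e) (hμ : ∀ i, μ i ≤ 1) {q : ι → ℝ} {B : ℝ}
    (hq : ∀ i, |q i| ≤ B) (x : E) :
    Summable fun i => (μ i * q i * inner ℝ x (A (e i))) • e i := by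
  have hc : Summable fun i => (√(μ i) * q i * inner ℝ (A (e i)) x) ^ 2 := by
    refine Summable.of_nonneg_of_le (fun _ => sq_nonneg _) (fun i => ?_)
      ((summable_inner_sq h.orthonormal_map x).mul_left (B ^ 2))
    rw [mul_pow, mul_pow, Real.sq_sqrt (h.pos i).le]
    gcongr
    calc μ i * q i ^ 2 ≤ 1 * B ^ 2 := by
          exact mul_le_mul (hμ i) (sq_le_sq.2 ((hq i).trans (le_abs_self B))) (sq_nonneg _)
            zero_le_one
      _ = _ := one_mul _
  refine (h.summable_smul_of_summable_sq hc).congr fun i => ?_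
  rw [real_inner_comm]
  congr 1
  linear_combination (q i * inner ℝ x (A (e i))) * Real.mul_self_sqrt (h.pos i).le

end IsSingularSystem

end SpectralRegularisation

open SpectralRegularisation in
theorem mainTheorem4 {X : Type*} [MeasurableSpace X] (P : Measure (X × Set.Icc (-1 : ℝ) 1))
    {H : Type*} [NormedAddCommGroup H] [InnerProductSpace ℝ H] [CompleteSpace H] [RKHS ℝ H X ℝ]
    (hk : Measurable fun p : X × X => realKernel H p.1 p.2)
    (hH : IsCompactlyEmbedded H P.fst)
    {ι : Type*} (μ : ι → ℝ) (e : ι → H) (hμe : IsEigensystem hH μ e) (hμ : ∀ i, μ i ≤ 1)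
    (β θ : ℝ) (hβ₀ : 0 < β) (hβ₁ : β < 1) (hθ₀ : 0 < θ) (hθ₁ : θ < 1)
    (r : ℝ≥0∞) (hr : 1 ≤ r) :
    ∃ C₁ C₂ : ℝ≥0, ∀ L : ℝ → ℝ → ℝ≥0, Measurable (fun p : ℝ × ℝ => L p.1 p.2) →
      ∀ f : X → ℝ, IsBayesDecisionFunction L P f → ∀ hf : MemLp f 2 P.fst,
      hf.toLp f ∈ interpSpace (classSpace hH) (classNorm hH) β r →
      ∀ g : ℝ → ℝ → ℝ, IsAdmissibleFilter g → ∀ l ∈ Set.Ioc (0 : ℝ) 1,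
        Summable (spectralRegTerm hH μ e g l (hf.toLp f)) ∧
        interpNorm (classSpace hH) (classNorm hH) θ r
            (embeddingOp hH (spectralReg hH μ e g l (hf.toLp f)) - hf.toLp f) ≤
          C₁ * (⨆ i, ENNReal.ofReal (|1 - μ i * g l (μ i)| * μ i ^ ((β - θ) / 2))) *
            interpNorm (classSpace hH) (classNorm hH) β r (hf.toLp f) ∧
        interpNorm (classSpace hH) (classNorm hH) θ r
            (embeddingOp hH (spectralReg hH μ e g l (hf.toLp f))) ≤
          C₂ * (⨆ i, ENNReal.ofReal (|μ i * g l (μ i)| * μ i ^ ((β - θ) / 2))) *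
            interpNorm (classSpace hH) (classNorm hH) β r (hf.toLp f) := by
  have h := isSingularSystem_embeddingOp hμe
  refine ⟨multiplierConst θ, multiplierConst θ, fun L _ f _ hf hfβ g hg l hl => ?_⟩
  set x := hf.toLp f
  obtain ⟨B, hB⟩ := hg.bounded_param
  -- This bound blows up as `l → 0`, but it serves only the convergence of the series and does not
  -- enter the constants.
  have hq : ∀ i, |g l (μ i)| ≤ B / l := fun i => by
    have := hB l hl (μ i) ⟨h.pos i, hμ i⟩
    rwa [abs_mul, abs_of_pos hl.1, ← le_div_iff₀' hl.1] at this
  have hsum : Summable (spectralRegTerm hH μ e g l x) := h.summable_filter_smul hμ hq x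
  have hreg : HasSum (fun i => (μ i * g l (μ i) * inner ℝ x (embeddingOp hH (e i))) •
      embeddingOp hH (e i)) (embeddingOp hH (spectralReg hH μ e g l x)) := by
    simpa [spectralReg, spectralRegTerm, Function.comp_def] using (embeddingOp hH).hasSum hsum.hasSum
  have hcoef : ∀ i, inner ℝ (embeddingOp hH (e i)) (embeddingOp hH (spectralReg hH μ e g l x)) =
      μ i * g l (μ i) * inner ℝ (embeddingOp hH (e i)) x := fun i => by
    rw [inner_of_hasSum_smul h.orthonormal_map hreg, real_inner_comm]
  have hx := h.hasSum_of_interpNorm_lt_top hβ₀ hr hfβ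
  refine ⟨hsum, ?_, ?_⟩
  · refine h.interpNorm_le_iSup_mul hβ₁ hθ₀ hθ₁ hr ?_ (s := fun i => μ i * g l (μ i) - 1)
      (fun i => abs_sub_comm _ _) fun i => ?_
    · simpa only [inner_sub_right, sub_smul] using (h.hasSum_map _).sub hx
    · rw [inner_sub_right, hcoef]; ring
  · exact h.interpNorm_le_iSup_mul hβ₁ hθ₀ hθ₁ hr (h.hasSum_map _) (fun _ => rfl) hcoef
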